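/- Let $\mathcal H=\bigoplus_{\ell=1}^L\mathcal H_\ell$ be a direct sum of finite-dimensional real Hilbert spaces with Euclidean norm $|||\cdot|||$, let $f:\mathcal H\to\mathbb R$ and $g_\ell:\mathcal H_\ell\to(-\infty,+\infty]$, and put $\Psi(\mathbf x)=f(\mathbf x)+\sum_{\ell=1}^L g_\ell(x_\ell)$. The Fréchet subdifferential $\hat\partial\Psi(\mathbf x)$ at $\mathbf x\in\mathrm{dom}\,\Psi$ is the set of $\mathbf s$ with $\liminf_{\mathbf y\to\mathbf x,\,\mathbf y\ne\mathbf x}\frac{\Psi(\mathbf y)-\Psi(\mathbf x)-\langle\mathbf y-\mathbf x,\mathbf s\rangle}{|||\mathbf x-\mathbf y|||}\ge 0$; the limiting subdifferential $\partial\Psi(\mathbf x)$ at $\mathbf x\in\mathrm{dom}\,\Psi$ is the set of limits of $\mathbf s^k\in\hat\partial\Psi(\mathbf x^k)$ along sequences $\mathbf x^k\to\mathbf x$ with $\Psi(\mathbf x^k)\to\Psi(\mathbf x)$; both are empty outside $\mathrm{dom}\,\Psi$. Assume: (A1) $\Psi$ is coercive, i.e. $\Psi(\mathbf x)\to+\infty$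 as $|||\mathbf x|||\to\infty$, and $\Psi$, $f$ and every $g_\ell$ are bounded below. (A2) $\Psi$ has the Kurdyka–Łojasiewicz property: for every $\mathbf a$ with $\partial\Psi(\mathbf a)\neq\emptyset$ there are $\eta\in(0,+\infty]$, a neighbourhood $U$ of $\mathbf a$ and a concave continuous $\varphi:[0,\eta)\to[0,\infty)$, $C^1$ on $(0,\eta)$, with $\varphi(0)=0$ and $\varphi'>0$ on $(0,\eta)$, such that $\varphi'(\Psi(\mathbf u)-\Psi(\mathbf a))\,\mathrm{dist}(0,\partial\Psi(\mathbf u))\ge 1$ for all $\mathbf u\in U$ with $\Psi(\mathbf a)<\Psi(\mathbf u)<\Psi(\mathbf a)+\eta$ (the distance to the empty set being $+\infty$). (A3) Every $g_\ell$ is proper and lower semicontinuous. (A4) $f$ is continuously differentiable, and there are constants $\beta_{\ell,j}>0$ such that, for all $\ell,j$, all $\mathbf x\in\mathcal H$ and all $v_j\in\mathcal H_j$, $\|\nabla_\ell f(\mathbf x+(0,\dots,0,v_j,0,\dots,0))-\nabla_\ell f(\mathbf x)\|\le\beta_{\ell,j}\|v_j\|$. (A5) The activations $\boldsymbol\varepsilon^n\in\{0,1\}^L$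 are such that, with $\mathbb I^n=\{\ell:\varepsilon^n_\ell=1\}$, there is an integer $K\ge1$ with $\bigcup_{n=j}^{j+K-1}\mathbb I^n=\{1,\dots,L\}$ for every $j\in\mathbb N$. Let the step sizes $\tau_\ell^n>0$ be bounded away from $0$ and from the admissible maximum: with $\beta_f^n=\big(\sum_{\ell=1}^L\sum_{j\in\mathbb I^n}\beta_{\ell,j}^2\big)^{1/2}$, $\inf\{\tau^n_\ell: n\in\mathbb N,\ \ell\in\mathbb I^n\}>0$ and $\inf\{1/\tau_\ell^n-\beta_f^n: n\in\mathbb N,\ \ell\in\mathbb I^n\}>0$. Let $(\mathbf x^n)_{n\in\mathbb N}$ be generated by FLEX-BC-PG: $g_\ell(x^0_\ell)<+\infty$ for all $\ell$; for $\ell\in\mathbb I^n$, $x_\ell^{n+1}$ is a minimizer over $u\in\mathcal H_\ell$ of $\frac1{2\tau_\ell^n}\|u-(x_\ell^n-\tau_\ell^n\nabla_\ell f(\mathbf x^n))\|^2+g_\ell(u)$; and $x_\ell^{n+1}=x_\ell^n$ for $\ell\notin\mathbb I^n$. Let $\bar{\mathbf x}^k=\mathbf x^{kK}$ be the cycle iterates.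 Then: 1. $(\bar{\mathbf x}^k)$ has finite length: $\sum_k|||\bar{\mathbf x}^k-\bar{\mathbf x}^{k+1}|||<\infty$. 2. $(\bar{\mathbf x}^k)$ converges to a critical point $\widehat{\mathbf x}$ of $\Psi$, i.e. $0\in\partial\Psi(\widehat{\mathbf x})$. -/

import Mathlib

open Filter Topology

noncomputable section

namespace FlexBCPG

/-! Extended-real-valued functions `Ψ : E → (-∞, +∞]` are modelled as maps into `EReal`;
the value `⊥` is excluded where it matters. -/

section Subdifferential

variable {E : Type*} [NormedAddCommGroup E] [InnerProductSpace ℝ E]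

/-- Fréchet subdifferential of `Ψ` at `x`; it is empty outside the domain of `Ψ`. -/
def frechetSubdiff (Ψ : E → EReal) (x : E) : Set E :=
  {s | Ψ x ≠ ⊤ ∧
    0 ≤ liminf (fun y : E =>
      (Ψ y - Ψ x - ((inner ℝ (y - x) s : ℝ) : EReal)) / ((‖x - y‖ : ℝ) : EReal)) (𝓝[≠] x)}

/-- Limiting subdifferential of `Ψ` at `x`; it is empty outside the domain of `Ψ`. -/
def limitingSubdiff (Ψ : E → EReal) (x : E) : Set E :=
  {s | Ψ x ≠ ⊤ ∧ ∃ (u : ℕ → E) (r : ℕ → E),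
    Tendsto u atTop (𝓝 x) ∧ Tendsto r atTop (𝓝 s) ∧
    Tendsto (fun k => Ψ (u k)) atTop (𝓝 (Ψ x)) ∧
    ∀ k, r k ∈ frechetSubdiff Ψ (u k)}

/-- The class of desingularizing functions on `[0, η)`, with `η ∈ (0, +∞]`. -/
structure IsDesingularizing (η : EReal) (φ : ℝ → ℝ) : Prop where
  concave : ConcaveOn ℝ {s : ℝ | 0 ≤ s ∧ (s : EReal) < η} φ
  continuousOn : ContinuousOn φ {s : ℝ | 0 ≤ s ∧ (s : EReal) < η}
  nonneg : ∀ s : ℝ, 0 ≤ s → (s : EReal) < η → 0 ≤ φ s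
  map_zero : φ 0 = 0
  contDiffOn : ContDiffOn ℝ 1 φ {s : ℝ | 0 < s ∧ (s : EReal) < η}
  deriv_pos : ∀ s : ℝ, 0 < s → (s : EReal) < η → 0 < deriv φ s

/-- The Kurdyka-Łojasiewicz property of `Ψ` at `a`. The distance is `[0, ∞]`-valued, so the
distance to an empty subdifferential is `∞`. -/
def HasKLAt (Ψ : E → EReal) (a : E) : Prop :=
  ∃ η : EReal, 0 < η ∧ ∃ U ∈ 𝓝 a, ∃ φ : ℝ → ℝ, IsDesingularizing η φ ∧
    ∀ u ∈ U, Ψ a < Ψ u → Ψ u < Ψ a + η →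
      1 ≤ ENNReal.ofReal (deriv φ (Ψ u - Ψ a).toReal) *
        Metric.infEDist 0 (limitingSubdiff Ψ u)

/-- `Ψ` is a KŁ function: it has the KŁ property at each point of the domain of its limiting
subdifferential. -/
def IsKL (Ψ : E → EReal) : Prop :=
  ∀ a : E, (limitingSubdiff Ψ a).Nonempty → HasKLAt Ψ a

/-- The (set-valued) proximity operator of `g` with parameter `τ`. -/
def prox (τ : ℝ) (g : E → EReal) (x : E) : Set E :=
  {u | ∀ v : E, ((1 / (2 * τ) * ‖u - x‖ ^ 2 : ℝ) : EReal) + g u ≤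
    ((1 / (2 * τ) * ‖v - x‖ ^ 2 : ℝ) : EReal) + g v}

end Subdifferential

section Blocks

variable {L : ℕ} {H : Fin L → Type*} [∀ ℓ, NormedAddCommGroup (H ℓ)]
  [∀ ℓ, InnerProductSpace ℝ (H ℓ)]

/-- The objective `Ψ(x) = f(x) + ∑ ℓ, g_ℓ(x_ℓ)` on the Hilbert direct sum of the blocks. -/
def objective (f : PiLp 2 H → ℝ) (g : ∀ ℓ, H ℓ → EReal) (x : PiLp 2 H) : EReal :=
  (f x : EReal) + ∑ ℓ, g ℓ (x ℓ)

/-- The partial gradient `∇_ℓ f(x)`: the `ℓ`-th block of the gradient. -/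
def blockGrad [∀ ℓ, CompleteSpace (H ℓ)] (f : PiLp 2 H → ℝ) (ℓ : Fin L) (x : PiLp 2 H) : H ℓ :=
  gradient f x ℓ

/-- The set of blocks activated by `ε ∈ {0,1}^L`. -/
def activeBlocks (ε : Fin L → Fin 2) : Finset (Fin L) :=
  Finset.univ.filter fun ℓ => ε ℓ = 1

/-- The Lipschitz modulus `(∑_{ℓ, j} ε_j β_{ℓ,j}^2)^{1/2}` of the active blocks. -/
def activeModulus (β : Fin L → Fin L → ℝ) (ε : Fin L → Fin 2) : ℝ :=
  Real.sqrt (∑ ℓ, ∑ j ∈ activeBlocks ε, β ℓ j ^ 2)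

/-- `x` is a sequence of iterates of the block-coordinate proximal gradient algorithm with
activations `ε` and step sizes `τ`: it starts in the domain of `∑ ℓ, g_ℓ`, and at iteration `n`
all active blocks make a proximal gradient step from `x n` while the others stay put. -/
structure IsFlexBCPG [∀ ℓ, CompleteSpace (H ℓ)] (f : PiLp 2 H → ℝ) (g : ∀ ℓ, H ℓ → EReal)
    (ε : ℕ → Fin L → Fin 2) (τ : ℕ → Fin L → ℝ) (x : ℕ → PiLp 2 H) : Prop where
  start : ∀ ℓ, g ℓ (x 0 ℓ) ≠ ⊤
  step_active : ∀ n ℓ, ε n ℓ = 1 →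
    x (n + 1) ℓ ∈ prox (τ n ℓ) (g ℓ) (x n ℓ - τ n ℓ • blockGrad f ℓ (x n))
  step_inactive : ∀ n ℓ, ε n ℓ = 0 → x (n + 1) ℓ = x n ℓ

/-- The iterate reached after `k` cycles of `K` iterations. -/
def cycleIterate (K : ℕ) (x : ℕ → PiLp 2 H) (k : ℕ) : PiLp 2 H := x (k * K)

end Blocks

end FlexBCPG

end

/-! Expanding the square in a prox step gives a quadratic minorant of `g ℓ` touching at the new
block. Tested at the old block and combined with the descent lemma for `f`, it yields sufficient
decrease (`objective_decrease`). At the end of a cycle every block still carries the minorant of its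
last update. Added to that of `f`, these form a minorant of the objective whose curvature does not
depend on the cycle, and whose slope is at most a multiple of the path length of the cycle
(`exists_relative_error`).

Such slopes are Fréchet subgradients, and the minorants survive limits: at a cluster point the
objective takes the limiting value and `0` is a subgradient (`quadratic_minorant_of_subseq`). The KŁ
inequality there bounds path lengths by a telescoping sum (`summable_of_hasKLAt`). Finite length
makes the cycle iterates Cauchy, so the cluster point is their limit. -/

namespace FlexBCPG

/-! ### Descent sequences of KŁ functions -/

section Abstract

variable {E : Type*} [NormedAddCommGroup E] [InnerProductSpace ℝ E]

/-- A quadratic lower minorant of `Ψ` touching at `x` has its slope in the Fréchet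
subdifferential. -/
lemma mem_frechetSubdiff_of_quadratic_minorant {Ψ : E → EReal} {x s : E} {p C : ℝ}
    (hx : Ψ x = p)
    (h : ∀ y, ((p + inner ℝ (y - x) s - C * ‖y - x‖ ^ 2 : ℝ) : EReal) ≤ Ψ y) :
    s ∈ frechetSubdiff Ψ x := by
  refine ⟨by simp [hx], le_of_forall_lt fun c hc => ?_⟩
  obtain ⟨c', hcc', hc'⟩ := EReal.lt_iff_exists_real_btwn.1 hc
  refine hcc'.trans_le (le_liminf_of_le (by isBoundedDefault) ?_)
  have hc0 : c' < 0 := by exact_mod_cast hc'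
  -- By the minorant, the difference quotient at `y` is at least `-C * ‖y - x‖`.
  have hlim : Tendsto (fun y : E => -C * ‖y - x‖) (𝓝[≠] x) (𝓝 0) := by
    have : Continuous fun y : E => -C * ‖y - x‖ := by fun_prop
    simpa using (this.tendsto x).mono_left nhdsWithin_le_nhds
  filter_upwards [hlim.eventually (lt_mem_nhds hc0), self_mem_nhdsWithin] with y hy hne
  have hpos : 0 < ‖x - y‖ := norm_pos_iff.2 (sub_ne_zero.2 (Ne.symm hne))
  rw [EReal.le_div_iff_mul_le (by exact_mod_cast hpos) (EReal.coe_ne_top _), hx]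
  have hy' := h y
  rw [norm_sub_rev] at hy
  rw [norm_sub_rev y x] at hy'
  induction hΨ : Ψ y with
  | bot => rw [hΨ] at hy'; exact absurd (le_bot_iff.1 hy') (EReal.coe_ne_bot _)
  | top =>
    rw [EReal.top_sub_coe, EReal.top_sub_coe]
    exact le_top
  | coe q =>
    rw [hΨ] at hy'
    norm_cast at hy' ⊢
    nlinarith

lemma frechetSubdiff_subset_limitingSubdiff (Ψ : E → EReal) (x : E) :
    frechetSubdiff Ψ x ⊆ limitingSubdiff Ψ x := fun s hs =>
  ⟨hs.1, fun _ => x, fun _ => s, tendsto_const_nhds, tendsto_const_nhds, tendsto_const_nhds,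
    fun _ => hs⟩

/-- Values and quadratic minorants pass to the limit along a subsequence. -/
lemma quadratic_minorant_of_subseq {Ψ : E → EReal} (hlsc : LowerSemicontinuous Ψ)
    {z s : ℕ → E} {p : ℕ → ℝ} {C l : ℝ} {x : E} (hp : ∀ k, Ψ (z k) = p k)
    (hz : Tendsto z atTop (𝓝 x)) (hs : Tendsto s atTop (𝓝 0)) (hl : Tendsto p atTop (𝓝 l))
    (h : ∀ k y, ((p k + inner ℝ (y - z k) (s k) - C * ‖y - z k‖ ^ 2 : ℝ) : EReal) ≤ Ψ y) :
    Ψ x = l ∧ ∀ y, ((l + inner ℝ (y - x) (0 : E) - C * ‖y - x‖ ^ 2 : ℝ) : EReal) ≤ Ψ y := by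
  have hmin : ∀ y, ((l + inner ℝ (y - x) (0 : E) - C * ‖y - x‖ ^ 2 : ℝ) : EReal) ≤ Ψ y := by
    intro y
    have hzy : Tendsto (fun k => y - z k) atTop (𝓝 (y - x)) := tendsto_const_nhds.sub hz
    have ht : Tendsto (fun k => p k + inner ℝ (y - z k) (s k) - C * ‖y - z k‖ ^ 2) atTop
        (𝓝 (l + inner ℝ (y - x) (0 : E) - C * ‖y - x‖ ^ 2)) :=
      (hl.add (hzy.inner hs)).sub ((hzy.norm.pow 2).const_mul C)
    exact le_of_tendsto ((continuous_coe_real_ereal.tendsto _).comp ht)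
      (Eventually.of_forall fun k => h k y)
  -- Lower semicontinuity gives `Ψ x ≤ l`; the limit minorant at `y = x` gives the converse.
  refine ⟨le_antisymm (le_of_forall_lt fun c hc => ?_) (by simpa using hmin x), hmin⟩
  obtain ⟨c', hcc', hc'⟩ := exists_between hc
  refine hcc'.trans_le (ge_of_tendsto ((continuous_coe_real_ereal.tendsto _).comp hl) ?_)
  filter_upwards [hz.eventually (hlsc x c' hc')] with k hk
  simpa [hp] using hk.le

/-- Concavity of the desingularizing function turns the KŁ inequality into a bound on the
decrease of the objective. -/
lemma IsDesingularizing.decrease_le {Ψ : E → EReal} {η : EReal} {φ : ℝ → ℝ}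
    (hφ : IsDesingularizing η φ) {a u s : E} {l p q : ℝ} (ha : Ψ a = l) (hu : Ψ u = p)
    (hKL : Ψ a < Ψ u → Ψ u < Ψ a + η →
      1 ≤ ENNReal.ofReal (deriv φ (Ψ u - Ψ a).toReal) * Metric.infEDist 0 (limitingSubdiff Ψ u))
    (hpη : ((p - l : ℝ) : EReal) < η) (hs : s ∈ limitingSubdiff Ψ u) (hlq : l ≤ q)
    (hqp : q ≤ p) :
    0 ≤ φ (p - l) - φ (q - l) ∧ p - q ≤ (φ (p - l) - φ (q - l)) * ‖s‖ := by
  rcases hqp.eq_or_lt with rfl | hqp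
  · simp
  have hlp := hlq.trans_lt hqp
  have hpη' : Ψ u < Ψ a + η := by
    rw [ha, hu]
    induction η with
    | bot => exact absurd hpη not_lt_bot
    | top => rw [EReal.coe_add_top]; exact EReal.coe_lt_top _
    | coe e => norm_cast at hpη ⊢; linarith
  have h1 := hKL (by rw [ha, hu]; exact_mod_cast hlp) hpη'
  rw [ha, hu, ← EReal.coe_sub, EReal.toReal_coe] at h1
  have hd := hφ.deriv_pos (p - l) (by linarith) hpη
  have h2 : 1 ≤ deriv φ (p - l) * ‖s‖ := by
    have := h1.trans (mul_le_mul_right (Metric.infEDist_le_edist_of_mem hs) _)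
    rw [edist_dist, dist_zero_left, ← ENNReal.ofReal_mul hd.le] at this
    rwa [ENNReal.one_le_ofReal] at this
  -- For a concave function the slope of a chord is at least the derivative at its right end.
  -- Differentiability follows from `deriv φ` being nonzero.
  have h3 : deriv φ (p - l) ≤ slope φ (q - l) (p - l) := by
    refine hφ.concave.deriv_le_slope ⟨by linarith, ?_⟩ ⟨by linarith, hpη⟩ (by linarith)
      (differentiableAt_of_deriv_ne_zero hd.ne')
    exact lt_of_le_of_lt (by exact_mod_cast (by linarith : q - l ≤ p - l)) hpη
  rw [slope_def_field, le_div_iff₀ (by linarith)] at h3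
  have h4 : 0 < deriv φ (p - l) * (p - l - (q - l)) := mul_pos hd (by linarith)
  refine ⟨by linarith, ?_⟩
  nlinarith [norm_nonneg s, mul_le_mul_of_nonneg_right h3 (norm_nonneg s)]

/-- A sequence with sufficient decrease and relative errors that comes close enough to a KŁ point
with the limiting value stays close to it and has finite length. -/
lemma summable_of_hasKLAt {Ψ : E → EReal} {z s : ℕ → E} {p d : ℕ → ℝ} {σ : ℕ → ℕ} {x : E}
    {a b c l : ℝ} (ha : 0 < a) (hb : 0 ≤ b) (hc : 0 ≤ c) (hd : ∀ k, 0 ≤ d k)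
    (hp : ∀ k, Ψ (z k) = p k) (hdec : ∀ k, p (k + 1) + a * d k ^ 2 ≤ p k)
    (hdist : ∀ k, ‖z k - z (k + 1)‖ ≤ c * d k)
    (hs : ∀ k, s (k + 1) ∈ limitingSubdiff Ψ (z (k + 1))) (hsd : ∀ k, ‖s (k + 1)‖ ≤ b * d k)
    (hl : Tendsto p atTop (𝓝 l)) (hd0 : Tendsto d atTop (𝓝 0)) (hσ : StrictMono σ)
    (hz : Tendsto (z ∘ σ) atTop (𝓝 x)) (hx : Ψ x = l) (hKL : HasKLAt Ψ x) :
    Summable d := by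
  obtain ⟨η, hη, U, hU, φ, hφ, hineq⟩ := hKL
  obtain ⟨ρ, hρ, hρU⟩ := Metric.mem_nhds_iff.1 hU
  have hanti : Antitone p := antitone_nat_of_succ_le fun k => by
    nlinarith [hdec k, mul_nonneg ha.le (sq_nonneg (d k))]
  have hlp : ∀ k, l ≤ p k := fun k => hanti.le_of_tendsto hl k
  have hpl : Tendsto (fun k => p k - l) atTop (𝓝 0) := by simpa using hl.sub_const l
  have hη' : ∀ᶠ k in atTop, ((p k - l : ℝ) : EReal) < η :=
    ((continuous_coe_real_ereal.tendsto _).comp hpl).eventually (gt_mem_nhds hη)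
  have hφ0 : Tendsto (fun k => φ (p k - l)) atTop (𝓝 0) := by
    have h0 := (hφ.continuousOn 0 ⟨le_rfl, hη⟩).tendsto
    rw [hφ.map_zero] at h0
    refine h0.comp (tendsto_nhdsWithin_iff.2 ⟨hpl, ?_⟩)
    filter_upwards [hη'] with k hk
    exact ⟨sub_nonneg.2 (hlp k), hk⟩
  have hσt := hσ.tendsto_atTop
  set M := b / a with hM
  have hM0 : 0 ≤ M := by positivity
  -- Distance to `x` plus a bound on all further travel: once below `ρ`, the sequence cannot leave
  -- the ball.
  have hT : Tendsto (fun k => ‖z (σ k) - x‖ + c * (d (σ k - 1) + M * φ (p (σ k) - l))) atTop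
      (𝓝 0) := by
    have h1 : Tendsto (fun k => ‖z (σ k) - x‖) atTop (𝓝 0) := by
      simpa using (hz.sub_const x).norm
    have h2 : Tendsto (fun k => d (σ k - 1)) atTop (𝓝 0) :=
      hd0.comp ((tendsto_sub_atTop_nat 1).comp hσt)
    simpa using h1.add ((h2.add ((hφ0.comp hσt).const_mul M)).const_mul c)
  obtain ⟨k, hk1, hk2, hk3⟩ := ((hT.eventually (gt_mem_nhds hρ)).and
    ((hσt.eventually hη').and (hσt.eventually (eventually_ge_atTop 1)))).exists
  obtain ⟨N, hN⟩ : ∃ N, σ k = N + 1 := ⟨σ k - 1, by omega⟩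
  rw [hN, Nat.add_sub_cancel] at hk1
  rw [hN] at hk2
  have hηN : ∀ m, ((p (N + 1 + m) - l : ℝ) : EReal) < η := fun m =>
    lt_of_le_of_lt (by exact_mod_cast sub_le_sub_right (hanti (Nat.le_add_right _ _)) l) hk2
  have hφnn : ∀ m, 0 ≤ φ (p (N + 1 + m) - l) := fun m =>
    hφ.nonneg _ (sub_nonneg.2 (hlp _)) (hηN m)
  -- The bound at `m` keeps the iterate `N + 1 + m` in `U`, so that KŁ applies there and gives the
  -- bound at `m + 1`.
  have key : ∀ m, ∑ i ∈ Finset.range m, d (N + 1 + i) + d (N + m) +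
      M * φ (p (N + 1 + m) - l) ≤ d N + M * φ (p (N + 1) - l) := by
    intro m
    induction m with
    | zero => simp
    | succ m ih =>
      have hsum : ∑ i ∈ Finset.range m, d (N + 1 + i) ≤ d N + M * φ (p (N + 1) - l) := by
        nlinarith [hd (N + m), mul_nonneg hM0 (hφnn m)]
      have hball : z (N + 1 + m) ∈ U := by
        apply hρU
        have h1 : dist (z (N + 1)) (z (N + 1 + m)) ≤
            ∑ i ∈ Finset.range m, c * d (N + 1 + i) :=
          dist_le_range_sum_of_dist_le (f := fun i => z (N + 1 + i)) m fun {i} _ => by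
            rw [dist_eq_norm]; exact hdist (N + 1 + i)
        rw [← Finset.mul_sum] at h1
        have h2 := dist_triangle_left (z (N + 1 + m)) x (z (N + 1))
        rw [dist_eq_norm (z (N + 1)) x] at h2
        rw [Metric.mem_ball]
        linarith [mul_le_mul_of_nonneg_left hsum hc]
      have h3 := hφ.decrease_le hx (hp (N + 1 + m)) (hineq _ hball) (hηN m)
        (by have := hs (N + m); rwa [add_right_comm] at this) (hlp (N + 1 + (m + 1)))
        (hanti (by omega))
      have h4 := hsd (N + m)
      rw [add_right_comm] at h4
      have h5 := hdec (N + 1 + m)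
      rw [add_assoc (N + 1) m 1] at h5
      set D := φ (p (N + 1 + m) - l) - φ (p (N + 1 + (m + 1)) - l) with hD
      have h6 : d (N + 1 + m) ^ 2 ≤ M * D * d (N + m) := by
        rw [hM, div_mul_eq_mul_div, div_mul_eq_mul_div, le_div_iff₀ ha]
        nlinarith [mul_le_mul_of_nonneg_left h4 h3.1]
      -- AM-GM applied to `h6`; summing over `m` telescopes both `d` and `φ`.
      have h7 : 2 * d (N + 1 + m) ≤ d (N + m) + M * D := by
        refine le_of_sq_le_sq ?_ (add_nonneg (hd _) (mul_nonneg hM0 h3.1))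
        nlinarith [sq_nonneg (d (N + m) - M * D)]
      rw [Finset.sum_range_succ, show N + (m + 1) = N + 1 + m by ring]
      have : M * D = M * φ (p (N + 1 + m) - l) - M * φ (p (N + 1 + (m + 1)) - l) := by
        rw [hD]; ring
      linarith
  rw [← summable_nat_add_iff (N + 1)]
  refine summable_of_sum_range_le (c := d N + M * φ (p (N + 1) - l)) (fun i => hd _) fun m => ?_
  simp only [add_comm _ (N + 1)]
  nlinarith [key m, hd (N + m), mul_nonneg hM0 (hφnn m)]

/-- Convergence of bounded descent sequences of KŁ functions whose relative errors are slopes of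
uniformly quadratic minorants. -/
theorem IsKL.finite_length_and_tendsto [ProperSpace E] {Ψ : E → EReal} (hKL : IsKL Ψ)
    (hlsc : LowerSemicontinuous Ψ) {z s : ℕ → E} {p d : ℕ → ℝ} {a b c C m : ℝ}
    (ha : 0 < a) (hb : 0 ≤ b) (hc : 0 ≤ c) (hd : ∀ k, 0 ≤ d k) (hp : ∀ k, Ψ (z k) = p k)
    (hm : ∀ k, m ≤ p k) (hbdd : Bornology.IsBounded (Set.range z))
    (hdec : ∀ k, p (k + 1) + a * d k ^ 2 ≤ p k)
    (hdist : ∀ k, ‖z k - z (k + 1)‖ ≤ c * d k) (hsd : ∀ k, ‖s (k + 1)‖ ≤ b * d k)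
    (hmin : ∀ k y, ((p (k + 1) + inner ℝ (y - z (k + 1)) (s (k + 1)) -
      C * ‖y - z (k + 1)‖ ^ 2 : ℝ) : EReal) ≤ Ψ y) :
    Summable (fun k => ‖z k - z (k + 1)‖) ∧
      ∃ x, Tendsto z atTop (𝓝 x) ∧ (0 : E) ∈ limitingSubdiff Ψ x := by
  have hanti : Antitone p := antitone_nat_of_succ_le fun k => by
    nlinarith [hdec k, mul_nonneg ha.le (sq_nonneg (d k))]
  obtain ⟨l, hl⟩ : ∃ l, Tendsto p atTop (𝓝 l) :=
    ⟨_, tendsto_atTop_ciInf hanti ⟨m, Set.forall_mem_range.2 hm⟩⟩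
  have hd0 : Tendsto d atTop (𝓝 0) := by
    have h1 : Tendsto (fun k => √((p k - p (k + 1)) / a)) atTop (𝓝 0) := by
      have := (((hl.sub (hl.comp (tendsto_add_atTop_nat 1))).div_const a).sqrt)
      simpa using this
    refine squeeze_zero hd (fun k => Real.le_sqrt_of_sq_le ?_) h1
    rw [le_div_iff₀ ha]
    linarith [hdec k]
  have hs0 : Tendsto (fun k => s (k + 1)) atTop (𝓝 0) :=
    squeeze_zero_norm hsd (by simpa using hd0.const_mul b)
  -- The shift is needed because slopes are controlled only from index `1` on.
  obtain ⟨x, -, σ, hσ, hx⟩ := tendsto_subseq_of_bounded hbdd (x := fun k => z (k + 1))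
    fun k => Set.mem_range_self _
  obtain ⟨hΨx, hxmin⟩ := quadratic_minorant_of_subseq hlsc (fun k => hp (σ k + 1)) hx
    (hs0.comp hσ.tendsto_atTop) (hl.comp ((tendsto_add_atTop_nat 1).comp hσ.tendsto_atTop))
    (fun k y => hmin (σ k) y)
  have hcrit : (0 : E) ∈ limitingSubdiff Ψ x :=
    frechetSubdiff_subset_limitingSubdiff _ _ (mem_frechetSubdiff_of_quadratic_minorant hΨx hxmin)
  have hsum : Summable d := summable_of_hasKLAt (σ := fun k => σ k + 1) ha hb hc hd hp hdec hdist
    (fun k => frechetSubdiff_subset_limitingSubdiff _ _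
      (mem_frechetSubdiff_of_quadratic_minorant (hp (k + 1)) (hmin k)))
    hsd hl hd0 (fun i j hij => Nat.succ_lt_succ (hσ hij)) hx hΨx (hKL x ⟨0, hcrit⟩)
  have hlen : Summable (fun k => ‖z k - z (k + 1)‖) :=
    Summable.of_nonneg_of_le (fun _ => norm_nonneg _) hdist (hsum.mul_left c)
  refine ⟨hlen, x, ?_, hcrit⟩
  have hcau : CauchySeq z := cauchySeq_of_summable_dist (by simpa only [dist_eq_norm] using hlen)
  exact tendsto_nhds_of_cauchySeq_of_subseq hcau
    ((tendsto_add_atTop_nat 1).comp hσ.tendsto_atTop) hx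

end Abstract

end FlexBCPG

namespace FlexBCPG

/-! ### Proximal points -/

section Prox

variable {E : Type*} [NormedAddCommGroup E]

lemma ne_top_of_mem_prox {τ : ℝ} {g : E → EReal} {w u : E} (hproper : ∃ v, g v ≠ ⊤)
    (hu : u ∈ prox τ g w) : g u ≠ ⊤ := by
  obtain ⟨v, hv⟩ := hproper
  intro htop
  have h := hu v
  rw [htop, EReal.coe_add_top, top_le_iff] at h
  exact (EReal.add_ne_top (EReal.coe_ne_top _) hv) h

variable [InnerProductSpace ℝ E]

/-- A proximal point has a quadratic minorant. -/
lemma add_le_of_mem_prox {τ : ℝ} (hτ : 0 < τ) {g : E → EReal} (hbot : ∀ v, g v ≠ ⊥)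
    {w u : E} (hu : u ∈ prox τ g w) (v : E) :
    g u + ((1 / τ * inner ℝ (w - u) (v - u) - 1 / (2 * τ) * ‖v - u‖ ^ 2 : ℝ) : EReal) ≤ g v := by
  by_cases hv : g v = ⊤
  · simp [hv]
  have hut := ne_top_of_mem_prox ⟨v, hv⟩ hu
  have h := hu v
  lift g v to ℝ using ⟨hv, hbot v⟩ with q
  lift g u to ℝ using ⟨hut, hbot u⟩ with p
  norm_cast at h ⊢
  have h1 : ‖v - w‖ ^ 2 = ‖v - u‖ ^ 2 - 2 * inner ℝ (w - u) (v - u) + ‖u - w‖ ^ 2 := by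
    rw [show v - w = (v - u) - (w - u) by abel, norm_sub_sq_real, real_inner_comm,
      norm_sub_rev w u]
  have h2 : 1 / τ = 2 * (1 / (2 * τ)) := by field_simp
  rw [h1] at h
  rw [h2]
  linarith

end Prox

/-! ### Descent lemma -/

section Descent

variable {E : Type*} [NormedAddCommGroup E] [InnerProductSpace ℝ E] [CompleteSpace E]

/-- The descent lemma along a segment. -/
lemma abs_sub_sub_inner_gradient_le {f : E → ℝ} (hf : Differentiable ℝ f) {x v : E} {M : ℝ}
    (h : ∀ t : ℝ, 0 ≤ t → ‖gradient f (x + t • v) - gradient f x‖ ≤ M * ‖t • v‖) :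
    |f (x + v) - f x - inner ℝ (gradient f x) v| ≤ M / 2 * ‖v‖ ^ 2 := by
  have hderiv : ∀ t : ℝ, HasDerivAt (fun t : ℝ => f (x + t • v) - f x -
      t * inner ℝ (gradient f x) v)
      (inner ℝ (gradient f (x + t • v)) v - inner ℝ (gradient f x) v) t := by
    intro t
    have h1 : HasDerivAt (fun t : ℝ => x + t • v) v t := by
      simpa using ((hasDerivAt_id t).smul_const v).const_add x
    have h2 := ((hf (x + t • v)).hasGradientAt.hasFDerivAt).comp_hasDerivAt t h1
    have h3 := (h2.sub_const (f x)).sub ((hasDerivAt_id t).mul_const (inner ℝ (gradient f x) v))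
    exact h3.congr_deriv (by simp)
  have hB : ∀ t : ℝ, HasDerivAt (fun t : ℝ => M / 2 * ‖v‖ ^ 2 * t ^ 2) (M * ‖v‖ ^ 2 * t) t := by
    intro t
    convert! (hasDerivAt_pow 2 t).const_mul (M / 2 * ‖v‖ ^ 2) using 1
    push_cast
    ring
  -- Mean value inequality: the Taylor remainder at `t` is dominated by `M / 2 * ‖v‖ ^ 2 * t ^ 2`.
  have := image_norm_le_of_norm_deriv_right_le_deriv_boundary (a := 0) (b := 1)
    (fun t _ => (hderiv t).continuousAt.continuousWithinAt)
    (fun t _ => (hderiv t).hasDerivWithinAt) (by simp) hB (fun t ht => by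
      rw [← inner_sub_left]
      refine (norm_inner_le_norm _ _).trans ?_
      have h1 := h t ht.1
      rw [norm_smul, Real.norm_of_nonneg ht.1] at h1
      nlinarith [mul_le_mul_of_nonneg_right h1 (norm_nonneg v)])
    (Set.right_mem_Icc.2 zero_le_one)
  simpa using this

end Descent

/-! ### Block structure and estimates along the iterates -/

section Blocks

variable {L : ℕ} {H : Fin L → Type*}

lemma objective_add_le {f : PiLp 2 H → ℝ} {g : ∀ ℓ, H ℓ → EReal} {x y : PiLp 2 H} {r₀ : ℝ}
    {r : Fin L → ℝ} (hf : f x + r₀ ≤ f y) (hg : ∀ ℓ, g ℓ (x ℓ) + (r ℓ : EReal) ≤ g ℓ (y ℓ)) :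
    objective f g x + ((r₀ + ∑ ℓ, r ℓ : ℝ) : EReal) ≤ objective f g y := by
  have hsum : ((∑ ℓ, r ℓ : ℝ) : EReal) = ∑ ℓ, (r ℓ : EReal) :=
    map_sum (⟨⟨Real.toEReal, EReal.coe_zero⟩, EReal.coe_add⟩ : ℝ →+ EReal) r Finset.univ
  have h1 : ((f x + r₀ : ℝ) : EReal) ≤ (f y : EReal) := by exact_mod_cast hf
  have h2 := add_le_add h1 (Finset.sum_le_sum fun ℓ (_ : ℓ ∈ Finset.univ) => hg ℓ)
  rw [Finset.sum_add_distrib, ← hsum] at h2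
  unfold objective
  refine le_trans (le_of_eq ?_) h2
  push_cast
  exact add_add_add_comm _ _ _ _

variable [∀ ℓ, NormedAddCommGroup (H ℓ)]

lemma norm_le_sum_norm (v : PiLp 2 H) : ‖v‖ ≤ ∑ ℓ, ‖v ℓ‖ := by
  refine le_of_sq_le_sq ?_ (Finset.sum_nonneg fun _ _ => norm_nonneg _)
  rw [PiLp.norm_sq_eq_of_L2]
  exact Finset.sum_sq_le_sq_sum_of_nonneg fun _ _ => norm_nonneg _

lemma lowerSemicontinuous_objective {f : PiLp 2 H → ℝ} {g : ∀ ℓ, H ℓ → EReal}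
    (hf : Continuous f) (hbot : ∀ ℓ u, g ℓ u ≠ ⊥) (hg : ∀ ℓ, LowerSemicontinuous (g ℓ)) :
    LowerSemicontinuous (objective f g) := by
  have hsum : ∀ S : Finset (Fin L), LowerSemicontinuous (fun x : PiLp 2 H => ∑ ℓ ∈ S, g ℓ (x ℓ)) ∧
      ∀ x : PiLp 2 H, ∑ ℓ ∈ S, g ℓ (x ℓ) ≠ ⊥ := by
    intro S
    induction S using Finset.induction_on with
    | empty => simpa using lowerSemicontinuous_const
    | insert ℓ S hℓ ih =>
      simp only [Finset.sum_insert hℓ]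
      refine ⟨LowerSemicontinuous.add' ((hg ℓ).comp (PiLp.continuous_apply 2 H ℓ)) ih.1
        fun x => EReal.continuousAt_add (.inr (ih.2 x)) (.inl (hbot _ _)), fun x => ?_⟩
      simp [EReal.add_eq_bot_iff, hbot, ih.2 x]
  exact LowerSemicontinuous.add' (continuous_coe_real_ereal.comp hf).lowerSemicontinuous
    (hsum Finset.univ).1 fun x => EReal.continuousAt_add (.inl (EReal.coe_ne_top _))
      (.inl (EReal.coe_ne_bot _))

variable [∀ ℓ, InnerProductSpace ℝ (H ℓ)] [∀ ℓ, CompleteSpace (H ℓ)]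

/-- The gradient is Lipschitz along increments supported on a set of blocks. -/
lemma norm_gradient_add_sub_le {f : PiLp 2 H → ℝ} {β : Fin L → Fin L → ℝ}
    (hf : ∀ (ℓ j : Fin L) (x : PiLp 2 H) (v : H j),
      ‖blockGrad f ℓ (x + WithLp.toLp 2 (Pi.single j v)) - blockGrad f ℓ x‖ ≤ β ℓ j * ‖v‖)
    (I : Finset (Fin L)) (x v : PiLp 2 H) (hv : ∀ j ∉ I, v j = 0) :
    ‖gradient f (x + v) - gradient f x‖ ≤ √(∑ ℓ, ∑ j ∈ I, β ℓ j ^ 2) * ‖v‖ := by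
  -- Blocks are changed one at a time; Cauchy–Schwarz then recombines the bounds.
  have hpart : ∀ (ℓ : Fin L) (S : Finset (Fin L)),
      ‖blockGrad f ℓ (x + ∑ j ∈ S, WithLp.toLp 2 (Pi.single j (v j))) - blockGrad f ℓ x‖ ≤
        ∑ j ∈ S, β ℓ j * ‖v j‖ := by
    intro ℓ S
    induction S using Finset.induction_on with
    | empty => simp
    | insert j S hj ih =>
      rw [Finset.sum_insert hj, Finset.sum_insert hj,
        add_comm (WithLp.toLp 2 (Pi.single j (v j))), ← add_assoc]
      exact (norm_sub_le_norm_sub_add_norm_sub _ _ _).trans (add_le_add (hf _ _ _ _) ih)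
  have hvI : ∑ j ∈ I, WithLp.toLp 2 (Pi.single j (v j)) = v := by
    ext ℓ
    rw [WithLp.ofLp_sum, Finset.sum_apply]
    by_cases hℓ : ℓ ∈ I
    · rw [Finset.sum_eq_single_of_mem ℓ hℓ fun j _ hj => Pi.single_eq_of_ne' hj _]
      simp
    · rw [hv ℓ hℓ]
      refine Finset.sum_eq_zero fun j hj => Pi.single_eq_of_ne' ?_ _
      rintro rfl
      exact hℓ hj
  refine le_of_sq_le_sq ?_ (by positivity)
  rw [mul_pow, Real.sq_sqrt (by positivity), PiLp.norm_sq_eq_of_L2, Finset.sum_mul]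
  refine Finset.sum_le_sum fun ℓ _ => ?_
  have h1 := hpart ℓ I
  rw [hvI] at h1
  calc ‖(gradient f (x + v) - gradient f x) ℓ‖ ^ 2
      ≤ (∑ j ∈ I, β ℓ j * ‖v j‖) ^ 2 := pow_le_pow_left₀ (norm_nonneg _) h1 2
    _ ≤ (∑ j ∈ I, β ℓ j ^ 2) * ∑ j ∈ I, ‖v j‖ ^ 2 := Finset.sum_mul_sq_le_sq_mul_sq _ _ _
    _ ≤ (∑ j ∈ I, β ℓ j ^ 2) * ‖v‖ ^ 2 := by
        rw [PiLp.norm_sq_eq_of_L2]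
        gcongr
        exact Finset.subset_univ I

namespace IsFlexBCPG

variable {f : PiLp 2 H → ℝ} {g : ∀ ℓ, H ℓ → EReal} {ε : ℕ → Fin L → Fin 2}
  {τ : ℕ → Fin L → ℝ} {x : ℕ → PiLp 2 H}

lemma eq_of_ne_one (hx : IsFlexBCPG f g ε τ x) {n : ℕ} {ℓ : Fin L} (h : ε n ℓ ≠ 1) :
    x (n + 1) ℓ = x n ℓ :=
  hx.step_inactive n ℓ (by omega)

lemma ne_top (hx : IsFlexBCPG f g ε τ x) (hproper : ∀ ℓ, ∃ u, g ℓ u ≠ ⊤) (n : ℕ) (ℓ : Fin L) :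
    g ℓ (x n ℓ) ≠ ⊤ := by
  induction n with
  | zero => exact hx.start ℓ
  | succ n ih =>
    by_cases h : ε n ℓ = 1
    · exact ne_top_of_mem_prox (hproper ℓ) (hx.step_active n ℓ h)
    · rwa [hx.eq_of_ne_one h]

/-- The last update of a block within a window where it is activated. -/
lemma exists_last_update (hx : IsFlexBCPG f g ε τ x) {ℓ : Fin L} {j K : ℕ}
    (h : ∃ n ∈ Set.Ico j (j + K), ε n ℓ = 1) :
    ∃ n ∈ Set.Ico j (j + K), ε n ℓ = 1 ∧ x (j + K) ℓ = x (n + 1) ℓ := by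
  induction K with
  | zero => simp at h
  | succ K ih =>
    by_cases hK : ε (j + K) ℓ = 1
    · exact ⟨j + K, ⟨by omega, by omega⟩, hK, rfl⟩
    · obtain ⟨n, hn, hn1⟩ := h
      have hne : n ≠ j + K := by rintro rfl; exact hK hn1
      obtain ⟨n', hn', h1, h2⟩ := ih ⟨n, ⟨hn.1, by have := hn.2; omega⟩, hn1⟩
      exact ⟨n', ⟨hn'.1, by have := hn'.2; omega⟩, h1, (hx.eq_of_ne_one hK).trans h2⟩

/-- Sufficient decrease of the objective at each iteration. -/
lemma objective_decrease (hx : IsFlexBCPG f g ε τ x) (hbot : ∀ ℓ u, g ℓ u ≠ ⊥)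
    (hf : Differentiable ℝ f) {β : Fin L → Fin L → ℝ}
    (hf_lip : ∀ (ℓ j : Fin L) (x : PiLp 2 H) (v : H j),
      ‖blockGrad f ℓ (x + WithLp.toLp 2 (Pi.single j v)) - blockGrad f ℓ x‖ ≤ β ℓ j * ‖v‖)
    (hτ : ∀ n ℓ, 0 < τ n ℓ) {δ : ℝ}
    (hδ : ∀ n ℓ, ε n ℓ = 1 → δ ≤ 1 / τ n ℓ - activeModulus β (ε n)) (n : ℕ) :
    objective f g (x (n + 1)) + ((δ / 2 * ‖x (n + 1) - x n‖ ^ 2 : ℝ) : EReal) ≤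
      objective f g (x n) := by
  set v := x (n + 1) - x n with hv
  have hxv : x (n + 1) = x n + v := by rw [hv]; abel
  set B := activeModulus β (ε n) with hB
  have hoff : ∀ j ∉ activeBlocks (ε n), v j = 0 := fun j hj => by
    rw [hv, PiLp.sub_apply, hx.eq_of_ne_one, sub_self]
    simpa [activeBlocks] using hj
  have hdesc : |f (x n + v) - f (x n) - inner ℝ (gradient f (x n)) v| ≤ B / 2 * ‖v‖ ^ 2 :=
    abs_sub_sub_inner_gradient_le hf fun t _ =>
      norm_gradient_add_sub_le hf_lip _ _ _ fun j hj => by simp [hoff j hj]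
  have hblock : ∀ ℓ, g ℓ (x (n + 1) ℓ) +
      ((inner ℝ (gradient f (x n) ℓ) (v ℓ) + (δ + B) / 2 * ‖v ℓ‖ ^ 2 : ℝ) : EReal) ≤
        g ℓ (x n ℓ) := by
    intro ℓ
    by_cases hℓ : ε n ℓ = 1
    -- With the old block as competitor, the quadratic terms leave `1 / τ - 1 / (2 * τ)`, which is
    -- at least `(δ + B) / 2`; the `B / 2` pays for the descent lemma.
    · refine le_trans (add_le_add le_rfl ?_)
        (add_le_of_mem_prox (hτ n ℓ) (hbot ℓ) (hx.step_active n ℓ hℓ) (x n ℓ))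
      have hvℓ : x (n + 1) ℓ = x n ℓ + v ℓ := by rw [hxv]; rfl
      have h1 : x n ℓ - τ n ℓ • blockGrad f ℓ (x n) - x (n + 1) ℓ =
          -(τ n ℓ • gradient f (x n) ℓ + v ℓ) := by
        rw [hvℓ, blockGrad]; abel
      have h2 : x n ℓ - x (n + 1) ℓ = -v ℓ := by rw [hvℓ]; abel
      have hτ' := hτ n ℓ
      rw [h1, h2, inner_neg_neg, inner_add_left, real_inner_smul_left,
        real_inner_self_eq_norm_sq, norm_neg]
      have h3 : 1 / τ n ℓ * (τ n ℓ * inner ℝ (gradient f (x n) ℓ) (v ℓ) + ‖v ℓ‖ ^ 2) -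
          1 / (2 * τ n ℓ) * ‖v ℓ‖ ^ 2 =
          inner ℝ (gradient f (x n) ℓ) (v ℓ) + (1 / τ n ℓ) / 2 * ‖v ℓ‖ ^ 2 := by
        field_simp
        ring
      rw [h3]
      norm_cast
      gcongr
      linarith [hδ n ℓ hℓ]
    · have hvℓ : v ℓ = 0 := hoff ℓ (by simpa [activeBlocks] using hℓ)
      simp [hvℓ, hx.eq_of_ne_one hℓ]
  refine le_trans (add_le_add le_rfl (le_of_eq ?_)) (objective_add_le
    (r₀ := -(inner ℝ (gradient f (x n)) v + B / 2 * ‖v‖ ^ 2)) ?_ hblock)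
  · congr 1
    rw [Finset.sum_add_distrib, ← Finset.mul_sum, ← PiLp.norm_sq_eq_of_L2, ← PiLp.inner_apply]
    ring
  · rw [hxv]
    linarith [(abs_le.1 hdesc).2]

/-- At the end of a cycle the objective has a quadratic minorant whose slope is controlled by the
path length of the cycle. -/
lemma exists_relative_error (hx : IsFlexBCPG f g ε τ x) (hbot : ∀ ℓ u, g ℓ u ≠ ⊥)
    (hf : Differentiable ℝ f) {Λ τmin : ℝ} (hΛ0 : 0 ≤ Λ)
    (hΛ : ∀ u v : PiLp 2 H, ‖gradient f (u + v) - gradient f u‖ ≤ Λ * ‖v‖)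
    (hτmin : 0 < τmin) (hτ : ∀ n ℓ, ε n ℓ = 1 → τmin ≤ τ n ℓ) {j K : ℕ}
    (hcyc : ∀ ℓ, ∃ n ∈ Set.Ico j (j + K), ε n ℓ = 1) :
    ∃ s : PiLp 2 H,
      ‖s‖ ≤ L * (1 / τmin + Λ) * ∑ n ∈ Finset.Ico j (j + K), ‖x (n + 1) - x n‖ ∧
      ∀ y, objective f g (x (j + K)) + ((inner ℝ (y - x (j + K)) s -
        (1 / (2 * τmin) + Λ / 2) * ‖y - x (j + K)‖ ^ 2 : ℝ) : EReal) ≤ objective f g y := by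
  choose N hN hact hlast using fun ℓ => hx.exists_last_update (hcyc ℓ)
  set z := x (j + K) with hz
  -- Slope of the prox minorant of `g ℓ` from the last update `N ℓ`, after which the block is
  -- already `z ℓ`.
  set q : ∀ ℓ, H ℓ := fun ℓ => (1 / τ (N ℓ) ℓ) •
    (x (N ℓ) ℓ - τ (N ℓ) ℓ • blockGrad f ℓ (x (N ℓ)) - z ℓ) with hq
  have hτpos : ∀ ℓ, 0 < τ (N ℓ) ℓ := fun ℓ => hτmin.trans_le (hτ _ _ (hact ℓ))
  refine ⟨gradient f z + WithLp.toLp 2 q, ?_, fun y => ?_⟩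
  · refine (norm_le_sum_norm _).trans ?_
    set D := ∑ n ∈ Finset.Ico j (j + K), ‖x (n + 1) - x n‖ with hD
    have hbound : ∀ ℓ, ‖(gradient f z + WithLp.toLp 2 q) ℓ‖ ≤ (1 / τmin + Λ) * D := by
      intro ℓ
      -- The slope splits into a scaled step and the change of the gradient since `N ℓ`; both are
      -- bounded by the path length `D`.
      have h1 : (gradient f z + WithLp.toLp 2 q) ℓ =
          (1 / τ (N ℓ) ℓ) • (x (N ℓ) - x (N ℓ + 1)) ℓ +
            (gradient f z - gradient f (x (N ℓ))) ℓ := by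
        simp only [PiLp.add_apply, PiLp.sub_apply, hq, hlast ℓ, blockGrad]
        rw [sub_right_comm, smul_sub (1 / τ (N ℓ) ℓ) (x (N ℓ) ℓ - x (N ℓ + 1) ℓ), smul_smul,
          one_div_mul_cancel (hτpos ℓ).ne', one_smul]
        abel
      have h2 : ‖(x (N ℓ) - x (N ℓ + 1)) ℓ‖ ≤ D := by
        refine (PiLp.norm_apply_le _ _).trans ?_
        rw [norm_sub_rev]
        exact Finset.single_le_sum (f := fun n => ‖x (n + 1) - x n‖)
          (fun n _ => norm_nonneg _) (Finset.mem_Ico.2 (hN ℓ))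
      have h3 : ‖(gradient f z - gradient f (x (N ℓ))) ℓ‖ ≤ Λ * D := by
        refine (PiLp.norm_apply_le _ _).trans ?_
        have h4 := hΛ (x (N ℓ)) (z - x (N ℓ))
        rw [add_sub_cancel] at h4
        refine h4.trans (mul_le_mul_of_nonneg_left ?_ hΛ0)
        rw [← dist_eq_norm, dist_comm]
        refine (dist_le_Ico_sum_dist x (hN ℓ).2.le).trans ?_
        simp only [dist_eq_norm, norm_sub_rev (x _) (x (_ + 1)), hD]
        exact Finset.sum_le_sum_of_subset_of_nonneg
          (Finset.Ico_subset_Ico_left (hN ℓ).1) fun _ _ _ => norm_nonneg _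
      rw [h1, add_mul]
      refine (norm_add_le _ _).trans (add_le_add ?_ h3)
      rw [norm_smul, Real.norm_of_nonneg (one_div_nonneg.2 (hτpos ℓ).le)]
      exact mul_le_mul (one_div_le_one_div_of_le hτmin (hτ _ _ (hact ℓ))) h2 (norm_nonneg _)
        (by positivity)
    refine (Finset.sum_le_sum fun ℓ _ => hbound ℓ).trans (le_of_eq ?_)
    simp [mul_assoc]
  · have hdesc := abs_sub_sub_inner_gradient_le hf (x := z) (v := y - z) fun t _ => hΛ z (t • (y - z))
    rw [add_sub_cancel] at hdesc
    have hblock : ∀ ℓ, g ℓ (z ℓ) + ((inner ℝ (q ℓ) ((y - z) ℓ) -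
        1 / (2 * τmin) * ‖(y - z) ℓ‖ ^ 2 : ℝ) : EReal) ≤ g ℓ (y ℓ) := by
      intro ℓ
      have hp := hx.step_active (N ℓ) ℓ (hact ℓ)
      rw [← hlast ℓ] at hp
      refine le_trans (add_le_add le_rfl ?_)
        (add_le_of_mem_prox (hτpos ℓ) (hbot ℓ) hp (y ℓ))
      rw [hq, real_inner_smul_left]
      norm_cast
      have h1 : 1 / (2 * τ (N ℓ) ℓ) ≤ 1 / (2 * τmin) :=
        one_div_le_one_div_of_le (by positivity) (by linarith [hτ _ _ (hact ℓ)])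
      have h2 := mul_le_mul_of_nonneg_right h1 (sq_nonneg ‖(y - z) ℓ‖)
      rw [PiLp.sub_apply] at h2 ⊢
      linarith
    refine le_trans (add_le_add le_rfl (le_of_eq ?_)) (objective_add_le
      (r₀ := inner ℝ (gradient f z) (y - z) - Λ / 2 * ‖y - z‖ ^ 2) ?_ hblock)
    · congr 1
      rw [Finset.sum_sub_distrib, ← Finset.mul_sum, ← PiLp.norm_sq_eq_of_L2, inner_add_right,
        real_inner_comm, real_inner_comm (WithLp.toLp 2 q), PiLp.inner_apply (WithLp.toLp 2 q)]
      simp only [PiLp.sub_apply]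
      ring
    · linarith [(abs_le.1 hdesc).1]

end IsFlexBCPG

end Blocks

end FlexBCPG

/-! ### Application to the cycle iterates -/

theorem theorem1 {L : ℕ} {H : Fin L → Type*}
    [∀ ℓ, NormedAddCommGroup (H ℓ)] [∀ ℓ, InnerProductSpace ℝ (H ℓ)]
    [∀ ℓ, CompleteSpace (H ℓ)] [∀ ℓ, FiniteDimensional ℝ (H ℓ)]
    (f : PiLp 2 H → ℝ) (g : ∀ ℓ, H ℓ → EReal)
    -- A1: coercivity and lower bounds
    (h_coercive : Filter.Tendsto (FlexBCPG.objective f g) (Bornology.cobounded (PiLp 2 H)) (nhds ⊤))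
    (h_bdd : ∃ m : ℝ, ∀ x, (m : EReal) ≤ FlexBCPG.objective f g x)
    (hf_bdd : ∃ m : ℝ, ∀ x, m ≤ f x)
    (hg_bdd : ∀ ℓ, ∃ m : ℝ, ∀ u, (m : EReal) ≤ g ℓ u)
    -- A2: the KŁ property
    (h_KL : FlexBCPG.IsKL (FlexBCPG.objective f g))
    -- A3: each `g_ℓ` is proper, with values in `(-∞, +∞]`, and lower semicontinuous
    (hg_ne_bot : ∀ ℓ u, g ℓ u ≠ ⊥)
    (hg_proper : ∀ ℓ, ∃ u, g ℓ u ≠ ⊤)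
    (hg_lsc : ∀ ℓ, LowerSemicontinuous (g ℓ))
    -- A4: `f` is continuously differentiable with block-Lipschitz partial gradients
    (hf_C1 : ContDiff ℝ 1 f)
    (β : Fin L → Fin L → ℝ) (hβ_pos : ∀ ℓ j, 0 < β ℓ j)
    (hf_lip : ∀ (ℓ j : Fin L) (x : PiLp 2 H) (v : H j),
      ‖FlexBCPG.blockGrad f ℓ (x + WithLp.toLp 2 (Pi.single j v)) - FlexBCPG.blockGrad f ℓ x‖ ≤ β ℓ j * ‖v‖)
    -- A5: parallel, essentially cyclic updates with cycle length `K`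
    (ε : ℕ → Fin L → Fin 2) (K : ℕ) (hK : 0 < K)
    (h_cyclic : ∀ j : ℕ, (⋃ n ∈ Set.Ico j (j + K), {ℓ : Fin L | ε n ℓ = 1}) = Set.univ)
    -- step sizes: positive, bounded away from `0` and from `1 / β_f^n` on the active blocks
    (τ : ℕ → Fin L → ℝ) (hτ_pos : ∀ n ℓ, 0 < τ n ℓ)
    (hτ_lower : ∃ τmin : ℝ, 0 < τmin ∧ ∀ n ℓ, ε n ℓ = 1 → τmin ≤ τ n ℓ)
    (hτ_upper : ∃ δ : ℝ, 0 < δ ∧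
      ∀ n ℓ, ε n ℓ = 1 → δ ≤ 1 / τ n ℓ - FlexBCPG.activeModulus β (ε n))
    -- the iterates
    (x : ℕ → PiLp 2 H) (hx : FlexBCPG.IsFlexBCPG f g ε τ x) :
    Summable (fun k : ℕ => ‖FlexBCPG.cycleIterate K x k - FlexBCPG.cycleIterate K x (k + 1)‖) ∧
    ∃ xhat : PiLp 2 H,
      Filter.Tendsto (FlexBCPG.cycleIterate K x) Filter.atTop (nhds xhat) ∧
      (0 : PiLp 2 H) ∈ FlexBCPG.limitingSubdiff (FlexBCPG.objective f g) xhat := by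
  have hf_diff : Differentiable ℝ f := hf_C1.differentiable one_ne_zero
  obtain ⟨τmin, hτmin, hτmin_le⟩ := hτ_lower
  obtain ⟨δ, hδ, hδ_le⟩ := hτ_upper
  obtain ⟨m, hm⟩ := h_bdd
  set Λ := √(∑ ℓ, ∑ j, β ℓ j ^ 2) with hΛ_def
  have hΛ : ∀ u v : PiLp 2 H, ‖gradient f (u + v) - gradient f u‖ ≤ Λ * ‖v‖ := fun u v =>
    FlexBCPG.norm_gradient_add_sub_le hf_lip Finset.univ u v (by simp)
  -- the objective is real-valued along the iterates
  have hfin : ∀ n, ∃ p : ℝ, FlexBCPG.objective f g (x n) = p := by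
    intro n
    choose G hG using fun ℓ => EReal.canLift.prf (g ℓ (x n ℓ))
      ⟨hx.ne_top hg_proper n ℓ, hg_ne_bot ℓ _⟩
    refine ⟨f (x n) + ∑ ℓ, G ℓ, ?_⟩
    simp only [FlexBCPG.objective, ← hG, EReal.coe_add]
    congr 1
    exact (map_sum (⟨⟨Real.toEReal, EReal.coe_zero⟩, EReal.coe_add⟩ : ℝ →+ EReal) G
      Finset.univ).symm
  choose p hp using hfin
  have hstep : ∀ n, p (n + 1) + δ / 2 * ‖x (n + 1) - x n‖ ^ 2 ≤ p n := fun n => by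
    have h := hx.objective_decrease hg_ne_bot hf_diff hf_lip hτ_pos hδ_le n
    rw [hp, hp] at h
    exact_mod_cast h
  -- The path length inside the cycle, not the distance between its ends, is what controls the
  -- slope.
  set d : ℕ → ℝ := fun k => ∑ n ∈ Finset.Ico (k * K) (k * K + K), ‖x (n + 1) - x n‖ with hd_def
  have hwindow : ∀ j N, p (j + N) + δ / 2 * ∑ n ∈ Finset.Ico j (j + N), ‖x (n + 1) - x n‖ ^ 2
      ≤ p j := by
    intro j N
    induction N with
    | zero => simp
    | succ N ih =>
      rw [← add_assoc, Finset.sum_Ico_succ_top (Nat.le_add_right j N)]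
      linarith [hstep (j + N)]
  have hK' : (0 : ℝ) < K := by exact_mod_cast hK
  have hdec : ∀ k, p ((k + 1) * K) + δ / (2 * K) * d k ^ 2 ≤ p (k * K) := by
    intro k
    -- Cauchy–Schwarz over the `K` steps, whence the constant `δ / (2 * K)`.
    have h1 : d k ^ 2 ≤ K * ∑ n ∈ Finset.Ico (k * K) (k * K + K), ‖x (n + 1) - x n‖ ^ 2 := by
      simpa using sq_sum_le_card_mul_sum_sq (s := Finset.Ico (k * K) (k * K + K))
        (f := fun n => ‖x (n + 1) - x n‖)
    have h2 := hwindow (k * K) K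
    have h3 := mul_le_mul_of_nonneg_left h1 (by positivity : 0 ≤ δ / (2 * K))
    rw [← mul_assoc, show δ / (2 * K) * K = δ / 2 by field_simp] at h3
    rw [Nat.succ_mul]
    linarith
  have hdist : ∀ k, ‖FlexBCPG.cycleIterate K x k - FlexBCPG.cycleIterate K x (k + 1)‖ ≤
      1 * d k := by
    intro k
    rw [one_mul, FlexBCPG.cycleIterate, FlexBCPG.cycleIterate, Nat.succ_mul, ← dist_eq_norm]
    refine (dist_le_Ico_sum_dist x (Nat.le_add_right _ _)).trans (le_of_eq ?_)
    simp only [hd_def, dist_eq_norm, norm_sub_rev (x _) (x (_ + 1))]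
  choose s hs hmin using fun k => hx.exists_relative_error hg_ne_bot hf_diff
    (Real.sqrt_nonneg _) hΛ hτmin hτmin_le (j := k * K) (K := K) fun ℓ => by
      have h : ℓ ∈ ⋃ n ∈ Set.Ico (k * K) (k * K + K), {ℓ : Fin L | ε n ℓ = 1} := by
        rw [h_cyclic]; trivial
      obtain ⟨n, hn, hℓ⟩ := Set.mem_iUnion₂.1 h
      exact ⟨n, hn, hℓ⟩
  have hanti : Antitone p := antitone_nat_of_succ_le fun n => by
    nlinarith [hstep n, mul_nonneg hδ.le (sq_nonneg ‖x (n + 1) - x n‖)]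
  -- The iterates stay in the sublevel set of `p 0`, which is bounded by coercivity.
  have hbounded : Bornology.IsBounded (Set.range (FlexBCPG.cycleIterate K x)) := by
    have h : {y | (p 0 : EReal) < FlexBCPG.objective f g y} ∈ Bornology.cobounded (PiLp 2 H) :=
      h_coercive.eventually (lt_mem_nhds (EReal.coe_lt_top _))
    refine (Bornology.isBounded_def.2 (by rwa [compl_compl]) :
      Bornology.IsBounded {y | (p 0 : EReal) < FlexBCPG.objective f g y}ᶜ).subset ?_
    rintro _ ⟨k, rfl⟩
    simp only [FlexBCPG.cycleIterate, Set.mem_compl_iff, Set.mem_ofPred_eq, hp, not_lt]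
    exact_mod_cast hanti (Nat.zero_le _)
  have : ProperSpace (PiLp 2 H) := FiniteDimensional.proper_real _
  exact h_KL.finite_length_and_tendsto
    (FlexBCPG.lowerSemicontinuous_objective hf_C1.continuous hg_ne_bot hg_lsc)
    -- `s k` is a slope at the end of cycle `k`, that is at cycle iterate `k + 1`, hence the shift;
    -- the value at `0` plays no role.
    (z := FlexBCPG.cycleIterate K x) (s := fun k => s (k - 1)) (p := fun k => p (k * K)) (d := d)
    (by positivity : 0 < δ / (2 * K)) (by positivity : 0 ≤ L * (1 / τmin + Λ)) zero_le_one
    (fun k => Finset.sum_nonneg fun _ _ => norm_nonneg _) (fun k => hp _)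
    (fun k => by have h := hm (x (k * K)); rw [hp] at h; exact_mod_cast h) hbounded hdec hdist
    hs (fun k y => by
      have h := hmin k y
      rw [← Nat.succ_mul, hp, ← EReal.coe_add, ← add_sub_assoc] at h
      exact h)
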